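/- Let $\mathbb{N}=\{1,2,3,\dots\}$ and let $-\Delta$ be the discrete Laplacian on the complex Hilbert space $\ell^2(\mathbb{N})$, $$(-\Delta u)_n=-u_{n-1}+2u_n-u_{n+1},\quad n\in\mathbb{N},\qquad u_0:=0,$$ a bounded positive self-adjoint operator; for $\alpha>0$ let $(-\Delta)^{\alpha}$ be its power, defined by the functional calculus. For $n\in\mathbb{N}$ and $\alpha\in(0,3/2)\setminus\{1/2,1\}$ put $$g_n(\alpha):=\left(1-\frac{(\alpha)_{2n}}{(1-\alpha)_{2n}}\right)\tan(\pi\alpha),\qquad (\alpha)_k:=\alpha(\alpha+1)\cdots(\alpha+k-1),$$ and let $g_n(1/2)$ and $g_n(1)$ be the limits of this expression as $\alpha\to1/2$ and $\alpha\to1$, that is, $$g_n\left(\tfrac12\right)=\frac{4}{\pi}\sum_{j=1}^{2n}\frac{1}{2j-1},\qquad g_n(1)=2\pi n .$$ Let $\alpha\in(0,3/2)$. If $V=\{V_n\}_{n=1}^{\infty}$ is a sequence of real numbers $V_n\geq0$ with $$\sum_{n=1}^{\infty}g_n(\alpha)V_n\leq 2\pi\,\frac{\Gamma(2\alpha)}{\Gamma(\alpha)^2},$$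 then the Hardy inequality $(-\Delta)^{\alpha}\geq V$ holds in the sense of quadratic forms, i.e. $$\langle\psi,(-\Delta)^{\alpha}\psi\rangle\geq\sum_{n=1}^{\infty}V_n|\psi_n|^2\quad\text{for all }\psi\in\ell^2(\mathbb{N})$$ (in particular the sum on the right converges). -/

import Mathlib

open scoped InnerProductSpace

noncomputable section

namespace DiscreteHardy

/-- The complex Hilbert space `ℓ²(ℕ)` with `ℕ = {1, 2, 3, …}`. -/
abbrev Ell2 : Type := lp (fun _ : ℕ+ => ℂ) 2

/-- The extension of a sequence `u₁, u₂, …` by the convention `u₀ = 0`. -/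
def zeroExt (u : ℕ+ → ℂ) (k : ℕ) : ℂ := if h : 0 < k then u ⟨k, h⟩ else 0

/-- The discrete Laplacian `(-Δ u)ₙ = -uₙ₋₁ + 2 uₙ - uₙ₊₁`, `n ≥ 1`, with `u₀ = 0`,
acting on arbitrary complex sequences. -/
def negLaplaceSeq (u : ℕ+ → ℂ) (n : ℕ+) : ℂ :=
  -zeroExt u (n - 1) + 2 * zeroExt u n - zeroExt u (n + 1)

@[simp] theorem zeroExt_coe (u : ℕ+ → ℂ) (n : ℕ+) : zeroExt u n = u n := by
  rw [zeroExt, dif_pos n.pos]; rfl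

@[simp] theorem zeroExt_succ (u : ℕ+ → ℂ) (n : ℕ+) : zeroExt u (n + 1) = u (n + 1) := by
  simpa using zeroExt_coe u (n + 1)

theorem succ_injective : Function.Injective (fun n : ℕ+ => n + 1) :=
  fun _ _ h => add_right_cancel h

theorem zeroExt_pred_succ (u : ℕ+ → ℂ) (n : ℕ+) : zeroExt u (((n + 1 : ℕ+) : ℕ) - 1) = u n := by
  simp

theorem zeroExt_pred_eq_zero (u : ℕ+ → ℂ) (n : ℕ+) (h : n ∉ Set.range (fun m : ℕ+ => m + 1)) :
    zeroExt u ((n : ℕ) - 1) = 0 := by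
  rcases eq_or_ne n 1 with rfl | hn
  · simp [zeroExt]
  · exact absurd ⟨n - 1, by simpa using PNat.sub_add_of_lt (lt_of_le_of_ne one_le hn.symm)⟩ h

theorem zeroExt_add (u v : Ell2) (k : ℕ) : zeroExt ⇑(u + v) k = zeroExt u k + zeroExt v k := by
  by_cases h : 0 < k
  · simp only [zeroExt, dif_pos h]; rfl
  · simp [zeroExt, h]

theorem zeroExt_smul (c : ℂ) (u : Ell2) (k : ℕ) : zeroExt ⇑(c • u) k = c • zeroExt u k := by
  by_cases h : 0 < k
  · simp only [zeroExt, dif_pos h]; rfl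
  · simp [zeroExt, h]

theorem memℓp_iff (u : ℕ+ → ℂ) : Memℓp u 2 ↔ Summable fun n => ‖u n‖ ^ 2 := by
  simpa using memℓp_gen_iff (p := 2) (f := u) (by norm_num)

theorem norm_sq (u : Ell2) : ‖u‖ ^ 2 = ∑' n, ‖u n‖ ^ 2 := by
  simpa using lp.norm_rpow_eq_tsum (p := 2) (by norm_num) u

/-- The backward shift `(S u)ₙ = uₙ₊₁`. -/
def backShift : Ell2 →L[ℂ] Ell2 :=
  LinearMap.mkContinuous
    { toFun := fun u => ⟨fun n => u (n + 1), (memℓp_iff _).2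
        (((memℓp_iff _).1 (lp.memℓp u)).comp_injective succ_injective)⟩
      map_add' := fun u v => by ext n; rfl
      map_smul' := fun c u => by ext n; rfl } 1 (by
    intro u
    rw [one_mul, ← sq_le_sq₀ (norm_nonneg _) (norm_nonneg _), norm_sq, norm_sq]
    have hs := (memℓp_iff _).1 (lp.memℓp u)
    exact (hs.comp_injective succ_injective).tsum_le_tsum_of_inj _ succ_injective
      (fun _ _ => by positivity) (fun _ => le_rfl) hs)

/-- The forward shift `(S* u)ₙ = uₙ₋₁` with `u₀ = 0`. -/
def forwardShift : Ell2 →L[ℂ] Ell2 :=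
  LinearMap.mkContinuous
    { toFun := fun u => ⟨fun n => zeroExt u (n - 1), (memℓp_iff _).2
        ((succ_injective.summable_iff (by
          intro n hn; simp [zeroExt_pred_eq_zero _ n hn])).1 (by
            simpa [Function.comp_def] using (memℓp_iff _).1 (lp.memℓp u)))⟩
      map_add' := fun u v => by ext n; exact zeroExt_add u v _
      map_smul' := fun c u => by ext n; exact zeroExt_smul c u _ } 1 (by
    intro u
    rw [one_mul, ← sq_le_sq₀ (norm_nonneg _) (norm_nonneg _), norm_sq, norm_sq]
    change ∑' n : ℕ+, ‖zeroExt u ((n : ℕ) - 1)‖ ^ 2 ≤ _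
    refine le_of_eq ?_
    rw [← succ_injective.tsum_eq (f := fun n : ℕ+ => ‖zeroExt u ((n : ℕ) - 1)‖ ^ 2)]
    · simp
    · intro n hn
      by_contra h
      exact hn (by simp [zeroExt_pred_eq_zero _ n h]))

theorem backShift_apply (u : Ell2) (n : ℕ+) : backShift u n = u (n + 1) := rfl

theorem forwardShift_apply (u : Ell2) (n : ℕ+) : forwardShift u n = zeroExt u (n - 1) := rfl

/-- The discrete Laplacian `-Δ` as a bounded operator on `ℓ²(ℕ)`; the next theorem says that it
acts by the difference expression. -/
def negLaplacian : Ell2 →L[ℂ] Ell2 :=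
  (2 : ℂ) • ContinuousLinearMap.id ℂ Ell2 - forwardShift - backShift

theorem negLaplacian_apply (u : Ell2) (n : ℕ+) : negLaplacian u n = negLaplaceSeq u n := by
  have h : negLaplacian u n = 2 * u n - forwardShift u n - backShift u n := rfl
  rw [h, negLaplaceSeq, forwardShift_apply, backShift_apply, zeroExt_coe, zeroExt_succ]
  ring

theorem inner_forwardShift (u v : Ell2) : ⟪forwardShift u, v⟫_ℂ = ⟪u, backShift v⟫_ℂ := by
  rw [lp.inner_eq_tsum, lp.inner_eq_tsum, ← succ_injective.tsum_eq]
  · simp [backShift_apply, forwardShift_apply]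
  · intro n hn
    by_contra h
    exact hn (by simp [forwardShift_apply, zeroExt_pred_eq_zero _ n h])

theorem inner_backShift (u v : Ell2) : ⟪backShift u, v⟫_ℂ = ⟪u, forwardShift v⟫_ℂ := by
  rw [← inner_conj_symm, ← inner_forwardShift, inner_conj_symm]

/-- The real power `T ^ α` of a positive bounded operator `T` on a complex Hilbert space, by the
continuous functional calculus. -/
def opPow {H : Type*} [NormedAddCommGroup H] [InnerProductSpace ℂ H] [CompleteSpace H]
    (T : H →L[ℂ] H) (α : ℝ) : H →L[ℂ] H :=
  T ^ α

/-- `-Δ` is a positive (in particular self-adjoint) operator, so that its real powers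
`(-Δ)^α` given by the continuous functional calculus are the genuine ones. -/
theorem negLaplacian_nonneg : 0 ≤ negLaplacian := by
  have hL (u : Ell2) : negLaplacian u = (2 : ℂ) • u - forwardShift u - backShift u := rfl
  rw [ContinuousLinearMap.nonneg_iff_isPositive]
  refine ⟨fun u v => ?_, fun u => ?_⟩
  · change ⟪negLaplacian u, v⟫_ℂ = ⟪u, negLaplacian v⟫_ℂ
    simp only [hL, inner_sub_left, inner_sub_right, inner_smul_left, inner_smul_right,
      inner_forwardShift, inner_backShift, map_ofNat]
    ring
  · have h1 : ‖backShift u‖ ≤ ‖u‖ := by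
      simpa using backShift.le_of_opNorm_le (LinearMap.mkContinuous_norm_le _ zero_le_one _) u
    have h2 : (⟪u, backShift u⟫_ℂ).re ≤ ‖u‖ ^ 2 := by
      calc (⟪u, backShift u⟫_ℂ).re ≤ ‖u‖ * ‖backShift u‖ := re_inner_le_norm (𝕜 := ℂ) u (backShift u)
        _ ≤ ‖u‖ * ‖u‖ := by gcongr
        _ = ‖u‖ ^ 2 := by ring
    have h3 : (⟪backShift u, u⟫_ℂ).re = (⟪u, backShift u⟫_ℂ).re := by
      rw [← inner_conj_symm, Complex.conj_re]
    have h4 : (⟪u, u⟫_ℂ).re = ‖u‖ ^ 2 := by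
      simpa using (norm_sq_eq_re_inner (𝕜 := ℂ) u).symm
    change 0 ≤ (⟪negLaplacian u, u⟫_ℂ).re
    simp only [hL, inner_sub_left, inner_smul_left, inner_forwardShift, map_ofNat, Complex.sub_re,
      Complex.mul_re, h3, h4]
    simp
    linarith

/-- The closed expression `(1 - (α)₂ₙ / (1 - α)₂ₙ) tan (π α)`; here `(α)ₖ` is the Pochhammer
symbol (rising factorial) `α (α + 1) ⋯ (α + k - 1)`. -/
def hardyCoeffFormula (n : ℕ+) (α : ℝ) : ℝ :=
  (1 - (ascPochhammer ℝ (2 * n)).eval α / (ascPochhammer ℝ (2 * n)).eval (1 - α)) *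
    Real.tan (Real.pi * α)

/-- The coefficient `gₙ(α)`, `0 < α < 3/2`. At `α = 1/2` and `α = 1` it is given by the limits of
the closed expression. -/
def hardyCoeff (n : ℕ+) (α : ℝ) : ℝ :=
  if α = 1 / 2 then 4 / Real.pi * ∑ j ∈ Finset.Icc 1 (2 * (n : ℕ)), 1 / (2 * (j : ℝ) - 1)
  else if α = 1 then 2 * Real.pi * n
  else hardyCoeffFormula n α

theorem eval_ascPochhammer_pos (k : ℕ) {x : ℝ} (hx : 0 < x) : 0 < (ascPochhammer ℝ k).eval x :=
  ascPochhammer_pos k x hx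

theorem hasDerivAt_ascPochhammer (k : ℕ) {x : ℝ} (hx : 0 < x) :
    HasDerivAt (fun y => (ascPochhammer ℝ k).eval y)
      ((ascPochhammer ℝ k).eval x * ∑ i ∈ Finset.range k, 1 / (x + i)) x := by
  induction k with
  | zero => simpa using hasDerivAt_const x (1 : ℝ)
  | succ k ih =>
    simp only [ascPochhammer_succ_eval, Finset.sum_range_succ]
    have hk : x + k ≠ 0 := by positivity
    refine (ih.mul ((hasDerivAt_id x).add_const (k : ℝ))).congr_deriv ?_
    simp only [id]
    field_simp

/-- The value of `gₙ` at `1/2` is the limit of the closed expression. -/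
theorem tendsto_hardyCoeffFormula_half (n : ℕ+) :
    Filter.Tendsto (hardyCoeffFormula n) (nhdsWithin (1 / 2) {1 / 2}ᶜ)
      (nhds (hardyCoeff n (1 / 2))) := by
  set S : ℝ := ∑ i ∈ Finset.range (2 * (n : ℕ)), 1 / ((1 / 2 : ℝ) + i) with hS
  set p : ℝ → ℝ := fun y => (ascPochhammer ℝ (2 * n)).eval y with hp
  have hp0 : p (1 / 2) ≠ 0 := (eval_ascPochhammer_pos _ (by norm_num)).ne'
  have hd : HasDerivAt p (p (1 / 2) * S) (1 / 2) := hasDerivAt_ascPochhammer _ (by norm_num)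
  have hd' : HasDerivAt (fun y => p (1 - y)) (-(p (1 / 2) * S)) (1 / 2) := by
    have : HasDerivAt p (p (1 / 2) * S) (1 - 1 / 2) := by norm_num at hd ⊢; exact hd
    simpa using this.comp_const_sub 1 (1 / 2)
  have hhalf : (1 : ℝ) - 1 / 2 = 1 / 2 := by norm_num
  have hF : HasDerivAt (fun y => 1 - p y / p (1 - y)) (-(2 * S)) (1 / 2) := by
    refine ((hd.div hd' (by rwa [hhalf])).const_sub 1).congr_deriv ?_
    rw [hhalf]
    field_simp
    ring
  have hC : HasDerivAt (fun y => Real.cos (Real.pi * y)) (-Real.pi) (1 / 2) := by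
    have := ((hasDerivAt_id (1 / 2 : ℝ)).const_mul Real.pi).cos
    have h2 : Real.pi * (1 / 2) = Real.pi / 2 := by ring
    simpa [h2, ← div_eq_mul_inv] using this
  have hsin : Filter.Tendsto (fun y => Real.sin (Real.pi * y)) (nhdsWithin (1 / 2) {1 / 2}ᶜ)
      (nhds 1) := by
    have h : Continuous fun y => Real.sin (Real.pi * y) := by fun_prop
    have h1 := h.tendsto (1 / 2)
    have h2 : Real.pi * (1 / 2) = Real.pi / 2 := by ring
    rw [h2, Real.sin_pi_div_two] at h1
    exact h1.mono_left nhdsWithin_le_nhds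
  have key := ((hasDerivAt_iff_tendsto_slope.1 hF).div (hasDerivAt_iff_tendsto_slope.1 hC)
    (by simp [Real.pi_ne_zero])).mul hsin
  have hval : -(2 * S) / -Real.pi * 1 = hardyCoeff n (1 / 2) := by
    have : S = 2 * ∑ j ∈ Finset.Icc 1 (2 * (n : ℕ)), 1 / (2 * (j : ℝ) - 1) := by
      rw [hS, ← Finset.Ico_add_one_right_eq_Icc, Finset.sum_Ico_eq_sum_range, Finset.mul_sum]
      refine Finset.sum_congr (by simp) fun i _ => ?_
      push_cast
      have h1 : (2 * (1 + (i : ℝ)) - 1) = 2 * i + 1 := by ring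
      rw [h1]
      have : (2 * (i : ℝ) + 1) ≠ 0 := by positivity
      have : (1 / 2 + (i : ℝ)) ≠ 0 := by positivity
      field_simp
      ring
    rw [hardyCoeff, if_pos rfl, this]
    field_simp
    ring
  rw [← hval]
  refine key.congr' ?_
  filter_upwards [self_mem_nhdsWithin] with y hy
  have hy' : y - 1 / 2 ≠ 0 := sub_ne_zero.2 hy
  have hc : Real.cos (Real.pi * (1 / 2)) = 0 := by
    rw [show Real.pi * (1 / 2) = Real.pi / 2 by ring, Real.cos_pi_div_two]
  simp only [Pi.div_apply, slope_def_field, hhalf, div_self hp0, hc, hardyCoeffFormula, sub_self,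
    sub_zero, Real.tan_eq_sin_div_cos]
  rw [div_div_div_cancel_right₀ hy']
  ring

/-- The value of `gₙ` at `1` is the limit of the closed expression. -/
theorem tendsto_hardyCoeffFormula_one (n : ℕ+) :
    Filter.Tendsto (hardyCoeffFormula n) (nhdsWithin 1 {1}ᶜ) (nhds (hardyCoeff n 1)) := by
  obtain ⟨k, hk⟩ : ∃ k, 2 * (n : ℕ) = k + 1 := ⟨2 * n - 1, by have := n.pos; omega⟩
  have hT : HasDerivAt (fun y => Real.tan (Real.pi * y)) Real.pi 1 := by
    have h := (Real.hasDerivAt_tan (x := Real.pi * 1) (by simp)).comp 1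
      ((hasDerivAt_id (1 : ℝ)).const_mul Real.pi)
    simpa [Function.comp_def] using h
  have hlim := hasDerivAt_iff_tendsto_slope.1 hT
  have htan : Filter.Tendsto (fun y => Real.tan (Real.pi * y)) (nhdsWithin 1 {1}ᶜ) (nhds 0) := by
    have h := hT.continuousAt.tendsto.mono_left (nhdsWithin_le_nhds (s := {1}ᶜ))
    simpa using h
  have hq : Filter.Tendsto (fun y : ℝ => (ascPochhammer ℝ (2 * n)).eval y /
      (ascPochhammer ℝ k).eval (1 - y + 1)) (nhdsWithin 1 {1}ᶜ) (nhds (2 * (n : ℝ))) := by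
    have h1 : (ascPochhammer ℝ k).eval ((1 : ℝ) - 1 + 1) = k.factorial := by
      simp [ascPochhammer_eval_one]
    have h2 : (ascPochhammer ℝ (2 * n)).eval (1 : ℝ) = (k + 1).factorial := by
      rw [hk, ascPochhammer_eval_one]
    have hc : ContinuousAt (fun y : ℝ => (ascPochhammer ℝ (2 * n)).eval y /
        (ascPochhammer ℝ k).eval (1 - y + 1)) 1 := by
      refine ContinuousAt.div (by fun_prop) (by fun_prop) ?_
      rw [h1]; positivity
    have h3 := hc.tendsto.mono_left (nhdsWithin_le_nhds (s := {1}ᶜ))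
    rw [h1, h2, Nat.factorial_succ, ← hk] at h3
    convert h3 using 2
    push_cast
    field_simp
  have key := htan.add (hq.mul hlim)
  have hval : 0 + 2 * (n : ℝ) * Real.pi = hardyCoeff n 1 := by
    rw [hardyCoeff, if_neg (by norm_num), if_pos rfl]; ring
  rw [← hval]
  refine key.congr' ?_
  filter_upwards [self_mem_nhdsWithin] with y hy
  have hy' : y - 1 ≠ 0 := sub_ne_zero.2 hy
  have hy'' : 1 - y ≠ 0 := sub_ne_zero.2 (Ne.symm hy)
  have hP : (ascPochhammer ℝ (2 * n)).eval (1 - y) =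
      (1 - y) * (ascPochhammer ℝ k).eval (1 - y + 1) := by
    rw [hk, ascPochhammer_succ_left]; simp
  rw [hardyCoeffFormula, hP, slope_def_field]
  simp only [mul_one, Real.tan_pi, sub_zero]
  rw [← div_div, ← neg_sub y 1, div_right_comm, div_neg]
  ring

/-- `H ≥ V` in the sense of quadratic forms, `⟨ψ, H ψ⟩ ≥ ⟨ψ, V ψ⟩ = ∑ₙ Vₙ |ψₙ|²` for all
`ψ ∈ ℓ²(ℕ)`, where the potential `V` acts as a diagonal operator; that the form of `V` is finite
on all of `ℓ²(ℕ)` is part of the definition. -/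
def FormGE (H : Ell2 →L[ℂ] Ell2) (V : ℕ+ → ℝ) : Prop :=
  ∀ ψ : Ell2, Summable (fun n => V n * ‖ψ n‖ ^ 2) ∧
    ∑' n, V n * ‖ψ n‖ ^ 2 ≤ (⟪ψ, H ψ⟫_ℂ).re

end DiscreteHardy

end

/-! ### Sine diagonalization of `-Δ`. -/

noncomputable section

namespace DiscreteHardy

/-! Everything follows from a pointwise bound, |ψₙ|² ≤ G(n,n) ⟨ψ, (-Δ)^α ψ⟩, where G(n,n) = ⟨eₙ,
(-Δ)^(-α) eₙ⟩ is the diagonal of the Green function. This is Cauchy-Schwarz for ⟨eₙ, ψ⟩ =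
⟨(-Δ)^(-α/2) eₙ, (-Δ)^(α/2) ψ⟩. Multiplying by Vₙ and summing gives the theorem, because G(n,n)
equals gₙ(α) divided by the constant 2πΓ(2α)/Γ(α)².

Since (-Δ)^(-α) is unbounded, it is replaced by ((-Δ)^α + ε)⁻¹ (`norm_inner_sq_le_mul`), and ε → 0
at the end (`norm_apply_sq_le`). The sines sin(nθ) diagonalize -Δ with symbol 2 - 2cos θ, so that
G(n,n) = (2/π) ∫₀^π sin²(nθ) (2 - 2cos θ)^(-α) dθ, which converges at θ = 0 because α < 3/2.

To evaluate it, sin²(nθ) is split into 2n terms sin((j + 1/2)θ) sin(θ/2)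
(`integral_sin_sq_mul_rpow`). The resulting integrals obey a first-order recurrence in j
(`sinIntegral_succ`) that starts from a Beta integral (`sinIntegral_zero`). The Pochhammer ratios so
obtained telescope (`sum_ascPochhammer_div`), and Gamma reflection produces the tangent
(`sum_sinIntegral`). -/

/-- The standard basis vectors of `ℓ²(ℕ)`, with the convention `stdVec 0 = 0`. -/
def stdVec (k : ℕ) : Ell2 := if h : 0 < k then lp.single 2 (⟨k, h⟩ : ℕ+) (1 : ℂ) else 0

theorem stdVec_zero : stdVec 0 = 0 := by simp [stdVec]

theorem inner_stdVec (k : ℕ) (u : Ell2) : ⟪stdVec k, u⟫_ℂ = zeroExt u k := by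
  by_cases h : 0 < k
  · rw [stdVec, dif_pos h, zeroExt, dif_pos h]
    refine (lp.inner_single_left (G := fun _ : ℕ+ => ℂ) (⟨k, h⟩ : ℕ+) (1 : ℂ) u).trans ?_
    simp
  · simp [stdVec, zeroExt, h]

theorem stdVec_apply (k : ℕ) (n : ℕ+) : stdVec k n = if (n : ℕ) = k then 1 else 0 := by
  by_cases h : 0 < k
  · rw [stdVec, dif_pos h]
    refine (lp.single_apply (E := fun _ : ℕ+ => ℂ) 2 (⟨k, h⟩ : ℕ+) (1 : ℂ) n).trans ?_
    refine (Pi.single_apply (M := ℂ) (⟨k, h⟩ : ℕ+) (1 : ℂ) n).trans ?_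
    congr 1
    exact propext Subtype.ext_iff
  · have : k = 0 := by omega
    subst this
    simp [stdVec_zero]

theorem zeroExt_stdVec (j k : ℕ) :
    zeroExt (stdVec k) j = if j = k ∧ 0 < k then 1 else 0 := by
  by_cases h : 0 < j
  · rw [zeroExt, dif_pos h]
    refine (stdVec_apply k ⟨j, h⟩).trans ?_
    congr 1
    simp only [PNat.mk_coe, eq_iff_iff]
    omega
  · rw [zeroExt, dif_neg h, if_neg (by omega)]

theorem negLaplacian_stdVec (k : ℕ) :
    negLaplacian (stdVec (k + 1)) =
      (2 : ℂ) • stdVec (k + 1) - stdVec k - stdVec (k + 2) := by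
  ext n
  have hr : ((2 : ℂ) • stdVec (k + 1) - stdVec k - stdVec (k + 2) : Ell2) n =
    2 * stdVec (k + 1) n - stdVec k n - stdVec (k + 2) n := rfl
  rw [negLaplacian_apply, negLaplaceSeq, hr]
  simp only [zeroExt_stdVec, stdVec_apply]
  have := n.pos
  by_cases h1 : (n : ℕ) = k
  · have a1 : ¬ ((n : ℕ) - 1 = k + 1) := by omega
    have a2 : ¬ ((n : ℕ) = k + 1) := by omega
    have a3 : ¬ ((n : ℕ) = k + 2) := by omega
    simp [h1]
  by_cases h2 : (n : ℕ) = k + 1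
  · simp [h2]
  by_cases h3 : (n : ℕ) = k + 2
  · simp [h3]
  · have a1 : ¬ ((n : ℕ) - 1 = k + 1) := by omega
    simp [h1, h2, h3, a1]

theorem integral_cos_int_mul (c : ℤ) :
    ∫ θ in (0 : ℝ)..Real.pi, Real.cos (c * θ) = if c = 0 then Real.pi else 0 := by
  by_cases h : c = 0
  · simp [h]
  · have hc : (c : ℝ) ≠ 0 := by exact_mod_cast h
    rw [intervalIntegral.integral_comp_mul_left _ hc, if_neg h]
    simp

theorem integral_sin_mul_sin (n m : ℕ) (hn : 0 < n) :
    ∫ θ in (0 : ℝ)..Real.pi, Real.sin (n * θ) * Real.sin (m * θ) =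
      if n = m then Real.pi / 2 else 0 := by
  have h (θ : ℝ) : Real.sin (n * θ) * Real.sin (m * θ) =
      (1 / 2) * (Real.cos (((n - m : ℤ) : ℝ) * θ) - Real.cos (((n + m : ℤ) : ℝ) * θ)) := by
    push_cast
    rw [sub_mul, add_mul, Real.cos_sub, Real.cos_add]
    ring
  simp_rw [h]
  rw [intervalIntegral.integral_const_mul, intervalIntegral.integral_sub
    (Continuous.intervalIntegrable (by fun_prop) _ _)
    (Continuous.intervalIntegrable (by fun_prop) _ _), integral_cos_int_mul, integral_cos_int_mul,
    if_neg (c := (n + m : ℤ) = 0) (by omega)]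
  by_cases hnm : n = m
  · simp [hnm]; ring
  · rw [if_neg (by omega), if_neg hnm]; simp

/-- The spectral representation of the matrix elements of a polynomial in `-Δ`. -/
theorem inner_stdVec_aeval (n : ℕ) (hn : 0 < n) (p : Polynomial ℝ) (m : ℕ) :
    ⟪stdVec n, Polynomial.aeval negLaplacian p (stdVec m)⟫_ℂ =
      ((2 / Real.pi * ∫ θ in (0 : ℝ)..Real.pi, Real.sin (n * θ) * Real.sin (m * θ) *
        p.eval (2 - 2 * Real.cos θ) : ℝ) : ℂ) := by
  have hint (q : Polynomial ℝ) (k : ℕ) : IntervalIntegrable (fun θ : ℝ =>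
      Real.sin (n * θ) * Real.sin (k * θ) * q.eval (2 - 2 * Real.cos θ))
      MeasureTheory.volume 0 Real.pi :=
    Continuous.intervalIntegrable (by fun_prop) _ _
  induction p using Polynomial.induction_on generalizing m with
  | C a =>
    have hs (c : ℝ) (x : Ell2) : (algebraMap ℝ (Ell2 →L[ℂ] Ell2) c) x = c • x := by
      rw [Algebra.algebraMap_eq_smul_one]; rfl
    simp only [Polynomial.eval_C, Polynomial.aeval_C]
    rw [intervalIntegral.integral_mul_const, integral_sin_mul_sin n m hn, hs,
      inner_smul_right_eq_smul, inner_stdVec,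
      zeroExt_stdVec]
    by_cases h : n = m
    · subst h
      simp [hn]
      field_simp
    · simp [h]
  | add p q hp hq =>
    simp only [map_add, add_apply, inner_add_right, hp, hq, Polynomial.eval_add,
      mul_add]
    rw [intervalIntegral.integral_add (hint p m) (hint q m)]
    push_cast
    ring
  | monomial k a ih =>
    -- The extra factor X acts first, as -Δ on the basis vector of index m. This yields indices m -
    -- 1, m, m + 1, hence the induction over all m.
    rw [pow_succ, ← mul_assoc]
    generalize Polynomial.C a * Polynomial.X ^ k = q at ih
    rw [map_mul, Polynomial.aeval_X, mul_apply_eq_comp]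
    -- For m = 0 both sides vanish, as `stdVec 0 = 0` and sin 0 = 0. This is the Dirichlet condition
    -- u₀ = 0.
    rcases m with _ | m
    · simp [stdVec_zero]
    rw [negLaplacian_stdVec]
    simp only [map_sub, map_smul, inner_sub_right, inner_smul_right, ih]
    rw [show (2 : ℂ) = ((2 : ℝ) : ℂ) by norm_num, ← Complex.ofReal_mul, ← Complex.ofReal_sub,
      ← Complex.ofReal_sub]
    congr 1
    rw [mul_left_comm, ← mul_sub, ← mul_sub, ← intervalIntegral.integral_const_mul,
      ← intervalIntegral.integral_sub ((hint q _).const_mul 2) (hint q _),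
      ← intervalIntegral.integral_sub (((hint q _).const_mul 2).sub (hint q _)) (hint q _)]
    congr 1
    -- With M = m + 1: 2 sin(Mθ) - sin((M - 1)θ) - sin((M + 1)θ) = (2 - 2cos θ) sin(Mθ).
    refine intervalIntegral.integral_congr fun θ _ => ?_
    have h1 : ((m : ℝ)) * θ = (m + 1) * θ - θ := by ring
    have h2 : ((m + 2 : ℕ) : ℝ) * θ = (m + 1) * θ + θ := by push_cast; ring
    simp only [Polynomial.eval_mul, Polynomial.eval_X, h1, h2, Real.sin_sub, Real.sin_add]
    push_cast
    ring

/-- The norm is at most 2 + 1 + 1, both shifts being contractions. The interval also contains the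
values of 2 - 2cos θ, so a single polynomial approximation on it controls both the operator and the
integral. -/
theorem spectrum_negLaplacian_subset : spectrum ℝ negLaplacian ⊆ Set.Icc 0 4 := by
  intro x hx
  have h0 : 0 ≤ x := spectrum_nonneg_of_nonneg negLaplacian_nonneg hx
  refine ⟨h0, ?_⟩
  have : Nontrivial Ell2 := ⟨stdVec 1, 0, fun h => by
    have := stdVec_apply 1 1
    rw [h] at this
    simp at this⟩
  have h1 : ‖x‖ ≤ ‖negLaplacian‖ := spectrum.norm_le_norm_of_mem hx
  have h2 : ‖negLaplacian‖ ≤ 4 := by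
    have hf : ‖forwardShift‖ ≤ 1 := LinearMap.mkContinuous_norm_le _ zero_le_one _
    have hb : ‖backShift‖ ≤ 1 := LinearMap.mkContinuous_norm_le _ zero_le_one _
    have hi : ‖(2 : ℂ) • ContinuousLinearMap.id ℂ Ell2‖ ≤ 2 := by
      rw [norm_smul]
      simp
    have := norm_sub_le ((2 : ℂ) • ContinuousLinearMap.id ℂ Ell2 - forwardShift) backShift
    have := norm_sub_le ((2 : ℂ) • ContinuousLinearMap.id ℂ Ell2) forwardShift
    unfold negLaplacian
    linarith
  rw [Real.norm_of_nonneg h0] at h1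
  linarith

theorem isSelfAdjoint_negLaplacian : IsSelfAdjoint negLaplacian :=
  IsSelfAdjoint.of_nonneg negLaplacian_nonneg

theorem norm_stdVec_le (n : ℕ) : ‖stdVec n‖ ≤ 1 := by
  by_cases h : 0 < n
  · rw [stdVec, dif_pos h]
    refine (lp.norm_single (E := fun _ : ℕ+ => ℂ) (p := 2) (by norm_num) (⟨n, h⟩ : ℕ+) (1 : ℂ)).le.trans ?_
    simp
  · simp [stdVec, h]

theorem two_sub_two_mul_cos_mem (θ : ℝ) : 2 - 2 * Real.cos θ ∈ Set.Icc (0 : ℝ) 4 :=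
  ⟨by linarith [Real.cos_le_one θ], by linarith [Real.neg_one_le_cos θ]⟩

/-! ### Continuous functional calculus and Cauchy-Schwarz. -/

/-- The continuous functional calculus of a self-adjoint bounded operator on a Hilbert space. -/
def opFun {H : Type*} [NormedAddCommGroup H] [InnerProductSpace ℂ H] [CompleteSpace H]
    (f : ℝ → ℝ) (T : H →L[ℂ] H) : H →L[ℂ] H :=
  cfc f T

/-- A spectral representation on polynomials extends to the continuous functional calculus. -/
theorem inner_cfc_eq_integral {H : Type*} [NormedAddCommGroup H] [InnerProductSpace ℂ H]
    [CompleteSpace H] {T : H →L[ℂ] H} (hT : IsSelfAdjoint T)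
    (hspec : spectrum ℝ T ⊆ Set.Icc 0 4) {e : H} (he : ‖e‖ ≤ 1) {w : ℝ → ℝ} (hw : Continuous w)
    (hw1 : ∀ θ, |w θ| ≤ 1)
    (hpoly : ∀ p : Polynomial ℝ, (⟪e, Polynomial.aeval T p e⟫_ℂ).re =
      2 / Real.pi * ∫ θ in (0 : ℝ)..Real.pi, w θ * p.eval (2 - 2 * Real.cos θ))
    {f : ℝ → ℝ} (hf : ContinuousOn f (Set.Icc 0 4)) :
    (⟪e, opFun f T e⟫_ℂ).re =
      2 / Real.pi * ∫ θ in (0 : ℝ)..Real.pi, w θ * f (2 - 2 * Real.cos θ) := by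
  have hfc : Continuous fun θ : ℝ => f (2 - 2 * Real.cos θ) :=
    hf.comp_continuous (by fun_prop) two_sub_two_mul_cos_mem
  refine eq_of_forall_dist_le fun ε hε => ?_
  -- The operator side costs ε/3 and the integral side (2/π) · π · ε/3 = 2ε/3.
  obtain ⟨p, hp⟩ := exists_polynomial_near_of_continuousOn 0 4 f hf (ε / 3) (by positivity)
  have hP := hpoly p
  rw [← cfc_polynomial p T hT] at hP
  have hfs := hf.mono hspec
  have h1 : |(⟪e, opFun f T e⟫_ℂ).re - (⟪e, cfc (fun x => p.eval x) T e⟫_ℂ).re| ≤ ε / 3 := by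
    rw [opFun, ← Complex.sub_re, ← inner_sub_right, ← sub_apply,
      ← cfc_sub f (fun x => p.eval x) T hfs (by fun_prop)]
    set A := cfc (fun x => f x - p.eval x) T
    have hA : ‖A‖ ≤ ε / 3 := by
      refine norm_cfc_le (by positivity) fun x hx => ?_
      rw [Real.norm_eq_abs, abs_sub_comm]
      exact (hp x (hspec hx)).le
    calc _ ≤ ‖⟪e, A e⟫_ℂ‖ := Complex.abs_re_le_norm _
      _ ≤ ‖e‖ * ‖A e‖ := norm_inner_le_norm _ _
      _ ≤ 1 * (ε / 3 * 1) := by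
        gcongr
        exact (A.le_of_opNorm_le hA _).trans (by gcongr)
      _ = ε / 3 := by ring
  have h2 : |(∫ θ in (0 : ℝ)..Real.pi, w θ * f (2 - 2 * Real.cos θ)) -
      ∫ θ in (0 : ℝ)..Real.pi, w θ * p.eval (2 - 2 * Real.cos θ)| ≤ ε / 3 * Real.pi := by
    have hi1 : IntervalIntegrable (fun θ => w θ * f (2 - 2 * Real.cos θ))
        MeasureTheory.volume 0 Real.pi := (hw.mul hfc).intervalIntegrable _ _
    have hi2 : IntervalIntegrable (fun θ => w θ * p.eval (2 - 2 * Real.cos θ))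
        MeasureTheory.volume 0 Real.pi := Continuous.intervalIntegrable (by fun_prop) _ _
    rw [← intervalIntegral.integral_sub hi1 hi2]
    have := intervalIntegral.norm_integral_le_of_norm_le_const (a := 0) (b := Real.pi)
      (C := ε / 3) (f := fun θ => w θ * f (2 - 2 * Real.cos θ) -
        w θ * p.eval (2 - 2 * Real.cos θ)) (fun θ _ => by
          rw [← mul_sub, norm_mul, Real.norm_eq_abs (_ - _), abs_sub_comm, Real.norm_eq_abs]
          have ha := hw1 θ
          have hb := (hp _ (two_sub_two_mul_cos_mem θ)).le
          calc _ ≤ 1 * (ε / 3) := by gcongr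
            _ = ε / 3 := by ring)
    rwa [sub_zero, abs_of_pos Real.pi_pos] at this
  rw [Real.dist_eq]
  rw [hP] at h1
  have h3 := mul_le_mul_of_nonneg_left h2 (show 0 ≤ 2 / Real.pi by positivity)
  have h4 : 2 / Real.pi * (ε / 3 * Real.pi) = 2 * (ε / 3) := by field_simp
  rw [h4] at h3
  nth_rewrite 1 [← abs_of_pos (show 0 < 2 / Real.pi by positivity)] at h3
  rw [← abs_mul, mul_sub] at h3
  rw [abs_le] at *
  constructor <;> linarith [h1.1, h1.2, h3.1, h3.2]

/-- The spectral representation of the diagonal matrix elements of `f(-Δ)`. -/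
theorem inner_stdVec_cfc (n : ℕ) (hn : 0 < n) {f : ℝ → ℝ} (hf : ContinuousOn f (Set.Icc 0 4)) :
    (⟪stdVec n, opFun f negLaplacian (stdVec n)⟫_ℂ).re =
      2 / Real.pi * ∫ θ in (0 : ℝ)..Real.pi, Real.sin (n * θ) ^ 2 * f (2 - 2 * Real.cos θ) := by
  refine inner_cfc_eq_integral (w := fun θ => Real.sin (n * θ) ^ 2) isSelfAdjoint_negLaplacian spectrum_negLaplacian_subset
    (norm_stdVec_le n) (by fun_prop) (fun θ => ?_) (fun p => ?_) hf
  · rw [abs_of_nonneg (sq_nonneg _)]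
    exact Real.sin_sq_le_one _
  · refine (congrArg Complex.re (inner_stdVec_aeval n hn p n)).trans ?_
    rw [Complex.ofReal_re]
    simp_rw [sq]

/-- The Cauchy-Schwarz inequality for the form of `T ^ α + ε`. -/
theorem norm_inner_sq_le_mul {H : Type*} [NormedAddCommGroup H] [InnerProductSpace ℂ H]
    [CompleteSpace H] {T : H →L[ℂ] H} (hT : 0 ≤ T) {α ε : ℝ} (hα : 0 < α) (hε : 0 < ε)
    (e ψ : H) :
    ‖⟪e, ψ⟫_ℂ‖ ^ 2 ≤ (⟪e, opFun (fun x : ℝ => (x ^ α + ε)⁻¹) T e⟫_ℂ).re *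
      ((⟪ψ, opPow T α ψ⟫_ℂ).re + ε * ‖ψ‖ ^ 2) := by
  have hsa : IsSelfAdjoint T := IsSelfAdjoint.of_nonneg hT
  have hspec : ∀ x ∈ spectrum ℝ T, 0 ≤ x := fun x hx => spectrum_nonneg_of_nonneg hT hx
  have hpos : ∀ x ∈ spectrum ℝ T, 0 < x ^ α + ε := fun x hx => by
    have := Real.rpow_nonneg (hspec x hx) α
    linarith
  have hc : Continuous fun x : ℝ => x ^ α := Real.continuous_rpow_const hα.le
  have hcs : Continuous fun x : ℝ => √(x ^ α + ε) := by fun_prop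
  have hci : ContinuousOn (fun x : ℝ => (√(x ^ α + ε))⁻¹) (spectrum ℝ T) :=
    hcs.continuousOn.inv₀ fun x hx => (Real.sqrt_pos.2 (hpos x hx)).ne'
  -- A and B are (T^α + ε)^(1/2) and its inverse. Positive ε keeps the inverse continuous on the
  -- spectrum even if 0 belongs to it.
  set A := cfc (fun x : ℝ => √(x ^ α + ε)) T with hA
  set B := cfc (fun x : ℝ => (√(x ^ α + ε))⁻¹) T with hB
  have hAsa : IsSelfAdjoint A := cfc_predicate _ T
  have hBsa : IsSelfAdjoint B := cfc_predicate _ T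
  have hBA : B * A = 1 := by
    rw [hA, hB, ← cfc_mul _ _ T hci hcs.continuousOn, ← cfc_one ℝ T]
    exact cfc_congr fun x hx => inv_mul_cancel₀ (Real.sqrt_pos.2 (hpos x hx)).ne'
  have hBB : opFun (fun x : ℝ => (x ^ α + ε)⁻¹) T = B * B := by
    rw [opFun, hB, ← cfc_mul _ _ T hci hci]
    refine cfc_congr fun x hx => ?_
    rw [← mul_inv, Real.mul_self_sqrt (hpos x hx).le]
  have hAA : A * A = opPow T α + ε • (1 : H →L[ℂ] H) := by
    rw [opPow, CFC.rpow_eq_cfc_real hT, hA, ← cfc_mul _ _ T hcs.continuousOn hcs.continuousOn,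
      ← Algebra.algebraMap_eq_smul_one, ← cfc_add_const ε _ T hc.continuousOn]
    exact cfc_congr fun x hx => Real.mul_self_sqrt (hpos x hx).le
  have hsymm {C : H →L[ℂ] H} (hC : IsSelfAdjoint C) (u v : H) : ⟪C u, v⟫_ℂ = ⟪u, C v⟫_ℂ :=
    (ContinuousLinearMap.isSelfAdjoint_iff_isSymmetric.1 hC) u v
  have hnorm {C : H →L[ℂ] H} (hC : IsSelfAdjoint C) (u : H) :
      ‖C u‖ ^ 2 = (⟪u, (C * C) u⟫_ℂ).re := by
    rw [mul_apply_eq_comp, ← hsymm hC]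
    exact norm_sq_eq_re_inner (𝕜 := ℂ) (C u)
  have h1 : ⟪e, ψ⟫_ℂ = ⟪B e, A ψ⟫_ℂ := by
    rw [hsymm hBsa, ← mul_apply_eq_comp, hBA]
    rfl
  have h2 : (⟪ψ, opPow T α ψ⟫_ℂ).re + ε * ‖ψ‖ ^ 2 = ‖A ψ‖ ^ 2 := by
    rw [hnorm hAsa, hAA, add_apply, inner_add_right, Complex.add_re]
    congr 1
    change _ = (⟪ψ, ε • ψ⟫_ℂ).re
    rw [inner_smul_right_eq_smul, Complex.smul_re, norm_sq_eq_re_inner (𝕜 := ℂ) ψ]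
    rfl
  rw [hBB, ← hnorm hBsa, h2, h1, ← mul_pow]
  gcongr
  exact norm_inner_le_norm _ _

end DiscreteHardy
end

/-! ### Trigonometric integrals with a power of 2 sin(θ/2). -/

noncomputable section

namespace DiscreteHardy

open Real MeasureTheory intervalIntegral

theorem sin_half_pos {θ : ℝ} (h : θ ∈ Set.Ioc 0 π) : 0 < sin (θ / 2) :=
  sin_pos_of_pos_of_lt_pi (by linarith [h.1]) (by linarith [h.1, h.2])

theorem div_pi_le_sin_half {θ : ℝ} (h0 : 0 ≤ θ) (h1 : θ ≤ π) : θ / π ≤ sin (θ / 2) := by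
  have := mul_le_sin (x := θ / 2) (by linarith) (by linarith)
  calc θ / π = 2 / π * (θ / 2) := by ring
    _ ≤ _ := this

theorem abs_sin_mul_le (c : ℝ) {θ : ℝ} (h0 : 0 ≤ θ) (h1 : θ ≤ π) :
    |sin (c * θ)| ≤ |c| * π * sin (θ / 2) := by
  have h := div_pi_le_sin_half h0 h1
  rw [div_le_iff₀ pi_pos] at h
  calc |sin (c * θ)| ≤ |c * θ| := abs_sin_le_abs
    _ = |c| * θ := by rw [abs_mul, abs_of_nonneg h0]
    _ ≤ |c| * (sin (θ / 2) * π) := by gcongr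
    _ = _ := by ring

theorem intervalIntegrable_sin_half_rpow {s : ℝ} (hs : -1 < s) :
    IntervalIntegrable (fun θ : ℝ => (2 * sin (θ / 2)) ^ s) volume 0 π := by
  rcases le_or_gt 0 s with h | h
  · refine Continuous.intervalIntegrable ?_ _ _
    exact Continuous.rpow_const (by fun_prop) fun _ => Or.inr h
  · have hi := (intervalIntegrable_rpow' (a := 0) (b := π) hs).const_mul ((2 / π) ^ s)
    refine hi.mono_fun' ?_ ?_
    · exact Measurable.aestronglyMeasurable (by fun_prop)
    · rw [Filter.EventuallyLE, ae_restrict_iff' measurableSet_uIoc]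
      refine Filter.Eventually.of_forall fun θ hθ => ?_
      rw [Set.uIoc_of_le pi_pos.le] at hθ
      have := sin_half_pos hθ
      rw [norm_of_nonneg (by positivity), ← mul_rpow (by positivity) hθ.1.le]
      have hpos : 0 < 2 / π * θ := mul_pos (by positivity) hθ.1
      refine rpow_le_rpow_of_nonpos hpos ?_ h.le
      have := div_pi_le_sin_half hθ.1.le hθ.2
      calc 2 / π * θ = 2 * (θ / π) := by ring
        _ ≤ _ := by linarith

/-- The zero of sin(cθ) at θ = 0 gains one power over `intervalIntegrable_sin_half_rpow`. For s = 1
- 2α the condition is exactly α < 3/2. -/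
theorem intervalIntegrable_sin_mul_rpow (c : ℝ) {s : ℝ} (hs : -2 < s) :
    IntervalIntegrable (fun θ : ℝ => sin (c * θ) * (2 * sin (θ / 2)) ^ s) volume 0 π := by
  have hi := (intervalIntegrable_sin_half_rpow (s := s + 1) (by linarith)).const_mul (|c| * π)
  refine hi.mono_fun' (Measurable.aestronglyMeasurable (by fun_prop)) ?_
  rw [Filter.EventuallyLE, ae_restrict_iff' measurableSet_uIoc]
  refine Filter.Eventually.of_forall fun θ hθ => ?_
  rw [Set.uIoc_of_le pi_pos.le] at hθ
  have h0 := sin_half_pos hθ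
  have h1 := abs_sin_mul_le c hθ.1.le hθ.2
  rw [norm_mul, norm_of_nonneg (rpow_nonneg (by positivity) _), norm_eq_abs,
    rpow_add_one (by positivity)]
  have : 0 ≤ (2 * sin (θ / 2)) ^ s := by positivity
  calc _ ≤ |c| * π * sin (θ / 2) * (2 * sin (θ / 2)) ^ s := by gcongr
    _ ≤ 2 * (|c| * π * sin (θ / 2) * (2 * sin (θ / 2)) ^ s) := by
      have : 0 ≤ |c| * π * sin (θ / 2) * (2 * sin (θ / 2)) ^ s := by positivity
      linarith
    _ = _ := by ring

theorem tendsto_sin_mul_rpow_zero (k : ℕ) {s : ℝ} (hs : -1 < s) :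
    Filter.Tendsto (fun θ : ℝ => sin (k * θ) * (2 * sin (θ / 2)) ^ s)
      (nhdsWithin 0 (Set.Ioi 0)) (nhds 0) := by
  have hlim : Filter.Tendsto (fun θ : ℝ => k * π * (2 * sin (θ / 2)) ^ (s + 1))
      (nhdsWithin 0 (Set.Ioi 0)) (nhds 0) := by
    have hc : Continuous fun θ : ℝ => k * π * (2 * sin (θ / 2)) ^ (s + 1) :=
      continuous_const.mul (Continuous.rpow_const (by fun_prop) fun _ => Or.inr (by linarith))
    have := (hc.tendsto 0).mono_left (nhdsWithin_le_nhds (s := Set.Ioi 0))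
    simpa [zero_rpow (show s + 1 ≠ 0 by linarith)] using this
  refine squeeze_zero_norm' ?_ hlim
  filter_upwards [Ioo_mem_nhdsGT pi_pos] with θ hθ
  have h0 := sin_half_pos ⟨hθ.1, hθ.2.le⟩
  have h1 := abs_sin_mul_le k hθ.1.le hθ.2.le
  rw [norm_mul, norm_of_nonneg (rpow_nonneg (by positivity) _), norm_eq_abs,
    rpow_add_one (by positivity)]
  rw [Nat.abs_cast] at h1
  have : 0 ≤ (2 * sin (θ / 2)) ^ s := by positivity
  have h3 : 0 ≤ k * π * sin (θ / 2) * (2 * sin (θ / 2)) ^ s := by positivity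
  calc _ ≤ k * π * sin (θ / 2) * (2 * sin (θ / 2)) ^ s := by gcongr
    _ ≤ 2 * (k * π * sin (θ / 2) * (2 * sin (θ / 2)) ^ s) := by linarith
    _ = _ := by ring

/-- The integrals `∫₀^π sin ((k + 1/2) θ) (2 sin (θ/2)) ^ (1 - 2α) dθ`. -/
def sinIntegral (α : ℝ) (k : ℕ) : ℝ :=
  ∫ θ in (0 : ℝ)..π, sin ((k + 1 / 2) * θ) * (2 * sin (θ / 2)) ^ (1 - 2 * α)

/-- The difference of the two integrands, with these coefficients, is the derivative of sin((k +
1)θ) (2 sin(θ/2))^(2 - 2α). The boundary terms vanish: at 0 because 2 - 2α > -1, at π because sin((k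
+ 1)π) = 0. -/
theorem sinIntegral_succ {α : ℝ} (hα : α < 3 / 2) (k : ℕ) :
    (k + 2 - α) * sinIntegral α (k + 1) = (α + k) * sinIntegral α k := by
  have hi (c : ℝ) := intervalIntegrable_sin_mul_rpow c (s := 1 - 2 * α) (by linarith)
  have h := integral_eq_sub_of_hasDerivAt_of_tendsto (a := 0) (b := π) (fa := 0) (fb := 0)
    (f := fun θ => sin ((k + 1 : ℕ) * θ) * (2 * sin (θ / 2)) ^ (2 - 2 * α))
    (f' := fun θ => (k + 2 - α) * (sin (((k + 1 : ℕ) + 1 / 2) * θ) *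
      (2 * sin (θ / 2)) ^ (1 - 2 * α)) - (α + k) * (sin ((k + 1 / 2) * θ) *
      (2 * sin (θ / 2)) ^ (1 - 2 * α))) pi_pos ?_ ?_ ?_ ?_
  · rw [integral_sub ((hi _).const_mul _) ((hi _).const_mul _), intervalIntegral.integral_const_mul,
      intervalIntegral.integral_const_mul] at h
    unfold sinIntegral
    linarith
  · intro θ hθ
    have h0 : 0 < 2 * sin (θ / 2) := by have := sin_half_pos ⟨hθ.1, hθ.2.le⟩; linarith
    have d1 : HasDerivAt (fun θ : ℝ => sin ((k + 1 : ℕ) * θ))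
        (cos ((k + 1 : ℕ) * θ) * (k + 1 : ℕ)) θ := by
      simpa using ((hasDerivAt_id θ).const_mul ((k + 1 : ℕ) : ℝ)).sin
    have d2 : HasDerivAt (fun θ : ℝ => 2 * sin (θ / 2)) (cos (θ / 2)) θ := by
      have := (((hasDerivAt_id θ).div_const 2).sin).const_mul 2
      refine this.congr_deriv ?_
      simp only [id]; ring
    have d3 := d1.mul (d2.rpow_const (p := 2 - 2 * α) (Or.inl h0.ne'))
    refine d3.congr_deriv ?_
    have e1 : (2 * sin (θ / 2)) ^ (2 - 2 * α) =
        (2 * sin (θ / 2)) ^ (1 - 2 * α) * (2 * sin (θ / 2)) := by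
      rw [← rpow_add_one h0.ne']; congr 1; ring
    rw [e1, show 2 - 2 * α - 1 = 1 - 2 * α by ring,
      show (((k + 1 : ℕ) : ℝ) + 1 / 2) * θ = (k + 1 : ℕ) * θ + θ / 2 by ring,
      show ((k : ℝ) + 1 / 2) * θ = (k + 1 : ℕ) * θ - θ / 2 by push_cast; ring, sin_add, sin_sub]
    push_cast
    ring
  · exact ((hi _).const_mul _).sub ((hi _).const_mul _)
  · exact tendsto_sin_mul_rpow_zero _ (by linarith)
  · have hc : ContinuousAt (fun θ : ℝ =>
        sin ((k + 1 : ℕ) * θ) * (2 * sin (θ / 2)) ^ (2 - 2 * α)) π := by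
      refine ContinuousAt.mul (by fun_prop) (ContinuousAt.rpow_const (by fun_prop) ?_)
      simp
    have := hc.tendsto.mono_left (nhdsWithin_le_nhds (s := Set.Iio π))
    simpa only [sin_nat_mul_pi, zero_mul] using this

theorem integral_rpow_mul_one_sub_rpow {a b : ℝ} (ha : 0 < a) (hb : 0 < b) :
    ∫ x in Set.Ioo (0 : ℝ) 1, x ^ (a - 1) * (1 - x) ^ (b - 1) =
      Gamma a * Gamma b / Gamma (a + b) := by
  have h := ProbabilityTheory.beta_eq_betaIntegralReal a b ha hb
  rw [ProbabilityTheory.beta] at h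
  rw [h, Complex.betaIntegral, ← integral_Ioc_eq_integral_Ioo,
    ← intervalIntegral.integral_of_le zero_le_one]
  rw [← Complex.ofReal_re (∫ x in (0 : ℝ)..1, _), ← intervalIntegral.integral_ofReal]
  congr 1
  refine integral_congr fun x hx => ?_
  rw [Set.uIcc_of_le zero_le_one] at hx
  rw [Complex.ofReal_mul, Complex.ofReal_cpow hx.1, Complex.ofReal_cpow (by linarith [hx.2])]
  push_cast
  rfl

/-- The substitution x = sin²(θ/2) turns the Beta integral with parameters (s + 1)/2 and 1/2 into
this one. -/
theorem integral_sin_half_rpow {s : ℝ} (hs : -1 < s) :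
    ∫ θ in (0 : ℝ)..π, sin (θ / 2) ^ s =
      Gamma ((s + 1) / 2) * Gamma (1 / 2) / Gamma (s / 2 + 1) := by
  have hb := integral_rpow_mul_one_sub_rpow (a := (s + 1) / 2) (b := 1 / 2) (by linarith)
    (by norm_num)
  rw [show (s + 1) / 2 + 1 / 2 = s / 2 + 1 by ring] at hb
  rw [← hb, intervalIntegral.integral_of_le pi_pos.le, integral_Ioc_eq_integral_Ioo]
  have himg : (fun θ : ℝ => sin (θ / 2) ^ 2) '' Set.Ioo 0 π = Set.Ioo 0 1 := by
    ext y
    constructor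
    · rintro ⟨θ, hθ, rfl⟩
      have h0 := sin_half_pos ⟨hθ.1, hθ.2.le⟩
      have h1 : 0 < cos (θ / 2) := cos_pos_of_mem_Ioo ⟨by linarith [hθ.1, pi_pos], by linarith [hθ.2]⟩
      refine ⟨by positivity, ?_⟩
      nlinarith [sin_sq_add_cos_sq (θ / 2)]
    · intro hy
      have h0 : 0 < √y := sqrt_pos.2 hy.1
      have h1 : √y < 1 := (sqrt_lt' one_pos).2 (by simpa using hy.2)
      refine ⟨2 * arcsin √y, ⟨by linarith [arcsin_pos.2 h0], ?_⟩, ?_⟩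
      · linarith [arcsin_lt_pi_div_two.2 h1]
      · simp only
        rw [mul_div_cancel_left₀ _ two_ne_zero, sin_arcsin (by linarith) h1.le, sq_sqrt hy.1.le]
  have hd (θ : ℝ) : HasDerivAt (fun θ : ℝ => sin (θ / 2) ^ 2) (sin (θ / 2) * cos (θ / 2)) θ := by
    refine ((((hasDerivAt_id θ).div_const 2).sin).pow 2).congr_deriv ?_
    simp only [id]; push_cast; ring
  have hinj : Set.InjOn (fun θ : ℝ => sin (θ / 2) ^ 2) (Set.Ioo 0 π) := by
    intro x hx y hy hxy
    have h1 := sin_half_pos ⟨hx.1, hx.2.le⟩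
    have h2 := sin_half_pos ⟨hy.1, hy.2.le⟩
    have h3 : sin (x / 2) = sin (y / 2) := (pow_left_inj₀ h1.le h2.le two_ne_zero).1 hxy
    have := injOn_sin ⟨by linarith [hx.1, pi_pos], by linarith [hx.2]⟩
      ⟨by linarith [hy.1, pi_pos], by linarith [hy.2]⟩ h3
    linarith
  rw [← himg, integral_image_eq_integral_abs_deriv_smul measurableSet_Ioo
    (fun θ _ => (hd θ).hasDerivWithinAt) hinj]
  refine setIntegral_congr_fun measurableSet_Ioo fun θ hθ => ?_
  have h0 := sin_half_pos ⟨hθ.1, hθ.2.le⟩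
  have h1 : 0 < cos (θ / 2) := cos_pos_of_mem_Ioo ⟨by linarith [hθ.1, pi_pos], by linarith [hθ.2]⟩
  simp only [smul_eq_mul]
  rw [abs_of_pos (by positivity), ← cos_sq', ← rpow_natCast, ← rpow_natCast, ← rpow_mul h0.le,
    ← rpow_mul h1.le, show ((2 : ℕ) : ℝ) * ((s + 1) / 2 - 1) = s - 1 by push_cast; ring,
    show ((2 : ℕ) : ℝ) * (1 / 2 - 1) = -1 by norm_num, rpow_neg_one, rpow_sub_one h0.ne']
  field_simp

theorem sinIntegral_zero {α : ℝ} (hα : α < 3 / 2) :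
    sinIntegral α 0 = π * Gamma (3 - 2 * α) / (2 * Gamma (2 - α) ^ 2) := by
  have h1 : sinIntegral α 0 =
      2 ^ (1 - 2 * α) * ∫ θ in (0 : ℝ)..π, sin (θ / 2) ^ (2 - 2 * α) := by
    rw [sinIntegral, ← intervalIntegral.integral_const_mul]
    rw [intervalIntegral.integral_of_le pi_pos.le, intervalIntegral.integral_of_le pi_pos.le]
    refine setIntegral_congr_fun measurableSet_Ioc fun θ hθ => ?_
    have h0 := sin_half_pos hθ
    simp only [Nat.cast_zero, zero_add]
    rw [mul_rpow two_pos.le h0.le, show 2 - 2 * α = 1 - 2 * α + 1 by ring, rpow_add_one h0.ne',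
      show 1 / 2 * θ = θ / 2 by ring]
    ring
  -- Legendre duplication removes Γ(3/2 - α) in favour of Γ(3 - 2α) and Γ(2 - α).
  have h2 := Gamma_mul_Gamma_add_half (3 / 2 - α)
  rw [show 3 / 2 - α + 1 / 2 = 2 - α by ring, show 2 * (3 / 2 - α) = 3 - 2 * α by ring,
    show 1 - (3 - 2 * α) = -(1 - 2 * α) - 1 by ring, rpow_sub_one two_ne_zero,
    rpow_neg two_pos.le] at h2
  have h3 : 0 < Gamma (2 - α) := Gamma_pos_of_pos (by linarith)
  have h4 : (0 : ℝ) < 2 ^ (1 - 2 * α) := by positivity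
  rw [h1, integral_sin_half_rpow (by linarith), Gamma_one_half_eq,
    show (2 - 2 * α + 1) / 2 = 3 / 2 - α by ring, show (2 - 2 * α) / 2 + 1 = 2 - α by ring]
  field_simp at h2 ⊢
  have h5 : √π * √π = π := mul_self_sqrt pi_pos.le
  linear_combination √π * h2 + Gamma (3 - 2 * α) * h5

theorem sinIntegral_eq {α : ℝ} (hα : α < 3 / 2) (k : ℕ) :
    sinIntegral α k = sinIntegral α 0 *
      ((ascPochhammer ℝ k).eval α / (ascPochhammer ℝ k).eval (2 - α)) := by
  induction k with
  | zero => simp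
  | succ k ih =>
    have h1 : (0 : ℝ) < k + 2 - α := by have : (0 : ℝ) ≤ k := k.cast_nonneg; linarith
    have h2 := sinIntegral_succ hα k
    have h3 := eval_ascPochhammer_pos k (x := 2 - α) (by linarith)
    rw [ascPochhammer_succ_eval, ascPochhammer_succ_eval]
    have h4 : 2 - α + k = k + 2 - α := by ring
    rw [h4]
    rw [ih] at h2
    apply mul_left_cancel₀ h1.ne'
    rw [h2]
    field_simp

/-- The diagonal of the Green function of `(-Δ) ^ α`. -/
theorem integral_sin_sq_mul_rpow {α : ℝ} (hα : α < 3 / 2) (n : ℕ) :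
    2 * ∫ θ in (0 : ℝ)..π, sin (n * θ) ^ 2 * (2 - 2 * cos θ) ^ (-α) =
      ∑ j ∈ Finset.range (2 * n), sinIntegral α j := by
  have hi (c : ℝ) := intervalIntegrable_sin_mul_rpow c (s := 1 - 2 * α) (by linarith)
  unfold sinIntegral
  rw [← intervalIntegral.integral_finsetSum fun j _ => hi _, ← intervalIntegral.integral_const_mul,
    intervalIntegral.integral_of_le pi_pos.le, intervalIntegral.integral_of_le pi_pos.le]
  refine setIntegral_congr_fun measurableSet_Ioc fun θ hθ => ?_
  have h0 := sin_half_pos hθ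
  have hS : 2 - 2 * cos θ = (2 * sin (θ / 2)) ^ (2 : ℕ) := by
    have := cos_sq' (θ / 2)
    have h2 := cos_two_mul (θ / 2)
    rw [show 2 * (θ / 2) = θ by ring] at h2
    rw [h2, this]; ring
  -- Telescoping: 2 sin(θ/2) sin((j + 1/2)θ) = cos(jθ) - cos((j + 1)θ). With k = 2n the sum is 1 -
  -- cos(2nθ) = 2 sin²(nθ), and the factor 2 sin(θ/2) raises the exponent from -2α to 1 - 2α.
  have hsum (k : ℕ) : ∑ j ∈ Finset.range k, sin ((j + 1 / 2) * θ) * (2 * sin (θ / 2)) =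
      1 - cos (k * θ) := by
    induction k with
    | zero => simp
    | succ k ih =>
      rw [Finset.sum_range_succ, ih,
        show ((k : ℝ) + 1 / 2) * θ = k * θ + θ / 2 by ring,
        show ((k + 1 : ℕ) : ℝ) * θ = k * θ + 2 * (θ / 2) by push_cast; ring, sin_add, cos_add,
        sin_two_mul, cos_two_mul, cos_sq']
      ring
  rw [hS, ← rpow_natCast (2 * sin (θ / 2)), ← rpow_mul (by positivity), show ((2 : ℕ) : ℝ) * -α = 1 - 2 * α - 1 by
    push_cast; ring, rpow_sub_one (by positivity), ← Finset.sum_mul]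
  have h1 := hsum (2 * n)
  rw [← Finset.sum_mul, show ((2 * n : ℕ) : ℝ) * θ = 2 * (n * θ) by push_cast; ring, cos_two_mul,
    cos_sq'] at h1
  have h2 : (0 : ℝ) < 2 * sin (θ / 2) := by linarith
  rw [eq_div_of_mul_eq h2.ne' h1]
  field_simp
  ring

/-- Here sin²(nθ) gains two powers at 0, leaving the exponent 2 - 2α > -1. -/
theorem intervalIntegrable_sin_sq_mul_rpow {α : ℝ} (hα : α < 3 / 2) (n : ℕ) :
    IntervalIntegrable (fun θ : ℝ => sin (n * θ) ^ 2 * (2 - 2 * cos θ) ^ (-α)) volume 0 π := by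
  have hi := (intervalIntegrable_sin_half_rpow (s := 2 - 2 * α) (by linarith)).const_mul
    ((n * π) ^ 2)
  refine hi.mono_fun' (Measurable.aestronglyMeasurable (by fun_prop)) ?_
  rw [Filter.EventuallyLE, ae_restrict_iff' measurableSet_uIoc]
  refine Filter.Eventually.of_forall fun θ hθ => ?_
  rw [Set.uIoc_of_le pi_pos.le] at hθ
  have h0 := sin_half_pos hθ
  have h1 := abs_sin_mul_le n hθ.1.le hθ.2
  rw [Nat.abs_cast] at h1
  have hS : 2 - 2 * cos θ = (2 * sin (θ / 2)) ^ (2 : ℕ) := by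
    have := cos_sq' (θ / 2)
    have h2 := cos_two_mul (θ / 2)
    rw [show 2 * (θ / 2) = θ by ring] at h2
    rw [h2, this]; ring
  have h2 : 0 < 2 * sin (θ / 2) := by linarith
  rw [hS, ← rpow_natCast (2 * sin (θ / 2)), ← rpow_mul h2.le, norm_mul,
    norm_of_nonneg (rpow_nonneg h2.le _), norm_pow, norm_eq_abs,
    show 2 - 2 * α = ((2 : ℕ) : ℝ) * -α + (2 : ℕ) by push_cast; ring, rpow_add_natCast h2.ne']
  have h3 : 0 < (2 * sin (θ / 2)) ^ (((2 : ℕ) : ℝ) * -α) := by positivity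
  calc _ ≤ (n * π * sin (θ / 2)) ^ 2 * (2 * sin (θ / 2)) ^ (((2 : ℕ) : ℝ) * -α) := by gcongr
    _ ≤ (n * π * (2 * sin (θ / 2))) ^ 2 * (2 * sin (θ / 2)) ^ (((2 : ℕ) : ℝ) * -α) := by
      gcongr
      linarith
    _ = _ := by ring

end DiscreteHardy
end

/-! ### Closed form of the Green function diagonal. -/

noncomputable section

namespace DiscreteHardy

open Real MeasureTheory

theorem ascPochhammer_eval_succ_left (x : ℝ) (k : ℕ) :
    (ascPochhammer ℝ (k + 1)).eval x = x * (ascPochhammer ℝ k).eval (x + 1) := by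
  rw [ascPochhammer_succ_left]; simp

/-- With T_k = (α)_k / (1 - α)_k, one has (1 - α)(T_k - T_{k+1}) = (1 - 2α) (α)_k / (2 - α)_k, so
the sum telescopes. -/
theorem sum_ascPochhammer_div {α : ℝ} (hα : α < 3 / 2) (h1 : α ≠ 1) (k : ℕ) :
    (1 - 2 * α) * ∑ j ∈ Finset.range k,
        (ascPochhammer ℝ j).eval α / (ascPochhammer ℝ j).eval (2 - α) =
      (1 - α) * (1 - (ascPochhammer ℝ k).eval α / (ascPochhammer ℝ k).eval (1 - α)) := by
  have h1' : 1 - α ≠ 0 := sub_ne_zero.2 h1.symm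
  have hne (j : ℕ) : (ascPochhammer ℝ j).eval (2 - α) ≠ 0 :=
    (eval_ascPochhammer_pos j (by linarith)).ne'
  induction k with
  | zero => simp
  | succ k ih =>
    have hl := ascPochhammer_eval_succ_left (1 - α) k
    rw [show 1 - α + 1 = 2 - α by ring] at hl
    have hr := ascPochhammer_succ_eval k (1 - α)
    -- For 1 < α the factor 1 - α is negative, so nonvanishing comes from (1 - α)_{k+1} = (1 - α)(2
    -- - α)_k instead of positivity.
    have hk : (ascPochhammer ℝ k).eval (1 - α) * (1 - α + k) ≠ 0 := by
      rw [← hr, hl]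
      exact mul_ne_zero h1' (hne k)
    have hk1 := left_ne_zero_of_mul hk
    have h2 : (ascPochhammer ℝ k).eval α / (ascPochhammer ℝ k).eval (1 - α) =
        (1 - α + k) * (ascPochhammer ℝ k).eval α /
          ((1 - α) * (ascPochhammer ℝ k).eval (2 - α)) := by
      rw [← hl, hr]
      field_simp
      rw [mul_div_cancel_right₀ _ (right_ne_zero_of_mul hk)]
    rw [Finset.sum_range_succ, mul_add, ih, h2, hl, ascPochhammer_succ_eval]
    have := hne k
    field_simp
    ring

/-- Compare the two factorizations of (1/2)_{j+1}: (1/2)(3/2)_j and (1/2)_j (1/2 + j). -/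
theorem ascPochhammer_half_div (j : ℕ) :
    (ascPochhammer ℝ j).eval (1 / 2) / (ascPochhammer ℝ j).eval (2 - 1 / 2) =
      1 / (2 * j + 1) := by
  have h1 := ascPochhammer_eval_succ_left (1 / 2) j
  rw [ascPochhammer_succ_eval, show (1 / 2 : ℝ) + 1 = 2 - 1 / 2 by norm_num] at h1
  have h2 := eval_ascPochhammer_pos j (x := 2 - 1 / 2) (by norm_num)
  have h3 : (0 : ℝ) < 2 * j + 1 := by positivity
  rw [div_eq_div_iff h2.ne' h3.ne']
  linarith

theorem sin_pi_mul_ne_zero {α : ℝ} (h0 : 0 < α) (h2 : α < 3 / 2) (h1 : α ≠ 1) :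
    sin (π * α) ≠ 0 := by
  rw [Ne, sin_eq_zero_iff]
  rintro ⟨m, hm⟩
  have hm' : (m : ℝ) = α := mul_left_cancel₀ pi_pos.ne' (by linarith)
  have a : 0 < m := by exact_mod_cast hm' ▸ h0
  have b : m < 2 := by
    have : (m : ℝ) < 2 := by linarith
    exact_mod_cast this
  have : m = 1 := by omega
  subst this
  exact h1 (by simpa using hm'.symm)

theorem cos_pi_mul_ne_zero {α : ℝ} (h0 : 0 < α) (h2 : α < 3 / 2) (h1 : α ≠ 1 / 2) :
    cos (π * α) ≠ 0 := by
  rw [Ne, cos_eq_zero_iff]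
  rintro ⟨m, hm⟩
  have hm' : (2 * m + 1 : ℝ) / 2 = α := mul_left_cancel₀ pi_pos.ne' (by linarith)
  have a : -1 < m := by
    have : (-1 : ℝ) < m := by linarith
    exact_mod_cast this
  have b : m < 1 := by
    have : (m : ℝ) < 1 := by linarith
    exact_mod_cast this
  have : m = 0 := by omega
  subst this
  exact h1 (by rw [← hm']; norm_num)

/-- Reflection at α and at 2α brings in sin²(πα) / sin(2πα) = tan(πα)/2. -/
theorem sinIntegral_zero_eq_tan {α : ℝ} (h0 : 0 < α) (h2 : α < 3 / 2) (hh : α ≠ 1 / 2)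
    (h1 : α ≠ 1) :
    sinIntegral α 0 * (1 - α) =
      (1 - 2 * α) * (Gamma α ^ 2 / (2 * Gamma (2 * α)) * tan (π * α)) := by
  have hs := sin_pi_mul_ne_zero h0 h2 h1
  have hc := cos_pi_mul_ne_zero h0 h2 hh
  have a1 : 1 - α ≠ 0 := sub_ne_zero.2 h1.symm
  have a2 : 1 - 2 * α ≠ 0 := fun h => hh (by linarith)
  have r1 := Gamma_mul_Gamma_one_sub α
  have r2 := Gamma_mul_Gamma_one_sub (2 * α)
  have g1 := Gamma_pos_of_pos h0
  have g2 := Gamma_pos_of_pos (show 0 < 2 * α by linarith)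
  have e1 : Gamma (2 - α) = (1 - α) * Gamma (1 - α) := by
    rw [← Gamma_add_one a1]; ring_nf
  have e2 : Gamma (3 - 2 * α) = 2 * (1 - α) * ((1 - 2 * α) * Gamma (1 - 2 * α)) := by
    rw [← Gamma_add_one a2, show 1 - 2 * α + 1 = 2 * (1 - α) by ring,
      ← Gamma_add_one (mul_ne_zero two_ne_zero a1)]
    ring_nf
  have e3 : Gamma (1 - α) = π / (sin (π * α) * Gamma α) := by
    field_simp at r1 ⊢; linarith
  have e4 : Gamma (1 - 2 * α) = π / (2 * sin (π * α) * cos (π * α) * Gamma (2 * α)) := by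
    rw [show π * (2 * α) = 2 * (π * α) by ring, sin_two_mul] at r2
    field_simp at r2 ⊢; linarith
  rw [sinIntegral_zero h2, e1, e2, e3, e4, tan_eq_sin_div_cos]
  have := pi_pos.ne'
  field_simp

/-- The diagonal of the Green function of `(-Δ) ^ α` in terms of the coefficients `gₙ(α)`. -/
theorem sum_sinIntegral {α : ℝ} (h0 : 0 < α) (h2 : α < 3 / 2) (n : ℕ+) :
    ∑ j ∈ Finset.range (2 * n), sinIntegral α j =
      Gamma α ^ 2 / (2 * Gamma (2 * α)) * hardyCoeff n α := by
  rw [Finset.sum_congr rfl fun j _ => sinIntegral_eq h2 j, ← Finset.mul_sum, hardyCoeff]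
  split_ifs with hh h1
  -- At α = 1/2 the ratios are 1/(2j + 1) and the zeroth integral is 2.
  · subst hh
    have h3 : Gamma (2 - 1 / 2) = 1 / 2 * √π := by
      rw [show (2 - 1 / 2 : ℝ) = 1 / 2 + 1 by norm_num, Gamma_add_one (by norm_num),
        Gamma_one_half_eq]
    rw [sinIntegral_zero h2, h3, show (3 - 2 * (1 / 2) : ℝ) = 1 + 1 by norm_num,
      show (2 * (1 / 2) : ℝ) = 1 by norm_num, Gamma_add_one one_ne_zero, Gamma_one,
      Gamma_one_half_eq, mul_pow, sq_sqrt pi_pos.le,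
      Finset.sum_congr rfl fun j _ => ascPochhammer_half_div j]
    rw [← Finset.Ico_add_one_right_eq_Icc, Finset.sum_Ico_eq_sum_range]
    have h4 : ∀ i : ℕ, 1 / (2 * ((1 + i : ℕ) : ℝ) - 1) = 1 / (2 * i + 1) := fun i => by
      congr 1; push_cast; ring
    simp only [h4, Nat.add_sub_cancel]
    have := pi_pos.ne'
    field_simp
    ring
  -- At α = 1 every ratio is 1, so each of the 2n integrals is π/2.
  · subst h1
    have h4 : ∀ j, (ascPochhammer ℝ j).eval (1 : ℝ) / (ascPochhammer ℝ j).eval (2 - 1) = 1 :=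
      fun j => by
        rw [show (2 - 1 : ℝ) = 1 by norm_num]
        exact div_self (eval_ascPochhammer_pos j one_pos).ne'
    rw [sinIntegral_zero h2, Finset.sum_congr rfl fun j _ => h4 j,
      show (3 - 2 * 1 : ℝ) = 1 by norm_num, show (2 - 1 : ℝ) = 1 by norm_num,
      show (2 * 1 : ℝ) = 1 + 1 by norm_num, Gamma_add_one one_ne_zero, Gamma_one]
    simp
    ring
  · have a2 : 1 - 2 * α ≠ 0 := fun h => hh (by linarith)
    have h3 := sinIntegral_zero_eq_tan h0 h2 hh h1
    have h4 := sum_ascPochhammer_div h2 h1 (2 * n)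
    apply mul_left_cancel₀ a2
    rw [mul_left_comm, h4, ← mul_assoc, h3, hardyCoeffFormula]
    ring

/-! ### The pointwise bound. -/

/-- Dropping ε only enlarges the integrand, and the resulting Green function bound no longer depends
on ε. -/
theorem inner_stdVec_inv_le {α ε : ℝ} (h0 : 0 < α) (h2 : α < 3 / 2) (hε : 0 < ε) (n : ℕ+) :
    (⟪stdVec n, opFun (fun x : ℝ => (x ^ α + ε)⁻¹) negLaplacian (stdVec n)⟫_ℂ).re ≤
      hardyCoeff n α / (2 * π * (Gamma (2 * α) / Gamma α ^ 2)) := by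
  have hx : ∀ x ∈ Set.Icc (0 : ℝ) 4, 0 < x ^ α + ε := fun x hx => by
    have := rpow_nonneg hx.1 α
    linarith
  have hf : ContinuousOn (fun x : ℝ => (x ^ α + ε)⁻¹) (Set.Icc 0 4) :=
    ((continuous_rpow_const h0.le).add continuous_const).continuousOn.inv₀
      fun x h => (hx x h).ne'
  rw [inner_stdVec_cfc n n.pos hf]
  have hmono : ∫ θ in (0 : ℝ)..π, sin (n * θ) ^ 2 * ((2 - 2 * cos θ) ^ α + ε)⁻¹ ≤
      ∫ θ in (0 : ℝ)..π, sin (n * θ) ^ 2 * (2 - 2 * cos θ) ^ (-α) := by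
    refine intervalIntegral.integral_mono_on_of_le_Ioo pi_pos.le ?_
      (intervalIntegrable_sin_sq_mul_rpow h2 n) fun θ hθ => ?_
    · have hc : Continuous fun θ : ℝ => ((2 - 2 * cos θ) ^ α + ε)⁻¹ :=
        hf.comp_continuous (by fun_prop) two_sub_two_mul_cos_mem
      have hs : Continuous fun θ : ℝ => sin (n * θ) ^ 2 := by fun_prop
      exact (hs.mul hc).intervalIntegrable _ _
    · have hcos : cos θ < 1 := by
        have := cos_lt_cos_of_nonneg_of_le_pi le_rfl hθ.2.le hθ.1
        rwa [cos_zero] at this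
      have hp : 0 < 2 - 2 * cos θ := by linarith
      rw [rpow_neg hp.le]
      have : 0 < (2 - 2 * cos θ) ^ α := rpow_pos_of_pos hp α
      gcongr
      linarith
  have hI := integral_sin_sq_mul_rpow h2 n
  rw [sum_sinIntegral h0 h2 n] at hI
  have g1 := Gamma_pos_of_pos h0
  have g2 := Gamma_pos_of_pos (show 0 < 2 * α by linarith)
  calc _ ≤ 2 / π * ∫ θ in (0 : ℝ)..π, sin (n * θ) ^ 2 * (2 - 2 * cos θ) ^ (-α) := by
        gcongr
    _ = (2 * ∫ θ in (0 : ℝ)..π, sin (n * θ) ^ 2 * (2 - 2 * cos θ) ^ (-α)) / π := by ring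
    _ = _ := by
        rw [hI]
        have := pi_pos.ne'
        field_simp

/-- The sign is not visible in the closed formula, but gₙ(α) is a positive multiple of the integral
of a nonnegative function. -/
theorem hardyCoeff_nonneg {α : ℝ} (h0 : 0 < α) (h2 : α < 3 / 2) (n : ℕ+) :
    0 ≤ hardyCoeff n α := by
  have hI := integral_sin_sq_mul_rpow h2 n
  rw [sum_sinIntegral h0 h2 n] at hI
  have g1 := Gamma_pos_of_pos h0
  have g2 := Gamma_pos_of_pos (show 0 < 2 * α by linarith)
  have hnn : 0 ≤ ∫ θ in (0 : ℝ)..π, sin (n * θ) ^ 2 * (2 - 2 * cos θ) ^ (-α) :=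
    intervalIntegral.integral_nonneg pi_pos.le fun θ _ =>
      mul_nonneg (sq_nonneg _) (rpow_nonneg (two_sub_two_mul_cos_mem θ).1 _)
  refine nonneg_of_mul_nonneg_right (b := hardyCoeff n α) ?_
    (show 0 < Gamma α ^ 2 / (2 * Gamma (2 * α)) by positivity)
  rw [← hI]
  linarith

theorem norm_apply_sq_le {α : ℝ} (h0 : 0 < α) (h2 : α < 3 / 2) (ψ : Ell2) (n : ℕ+) :
    ‖ψ n‖ ^ 2 ≤ hardyCoeff n α / (2 * π * (Gamma (2 * α) / Gamma α ^ 2)) *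
      (⟪ψ, opPow negLaplacian α ψ⟫_ℂ).re := by
  have g1 := Gamma_pos_of_pos h0
  have g2 := Gamma_pos_of_pos (show 0 < 2 * α by linarith)
  set D := hardyCoeff n α / (2 * π * (Gamma (2 * α) / Gamma α ^ 2))
  set Q := (⟪ψ, opPow negLaplacian α ψ⟫_ℂ).re
  have hQ : 0 ≤ Q := by
    have : 0 ≤ opPow negLaplacian α := CFC.rpow_nonneg
    exact ((ContinuousLinearMap.nonneg_iff_isPositive _).1 this).re_inner_nonneg_right ψ
  have key : ∀ ε : ℝ, 0 < ε → ‖ψ n‖ ^ 2 ≤ D * (Q + ε * ‖ψ‖ ^ 2) := fun ε hε => by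
    have h := norm_inner_sq_le_mul negLaplacian_nonneg h0 hε (stdVec n) ψ
    rw [inner_stdVec, zeroExt_coe] at h
    refine h.trans (mul_le_mul_of_nonneg_right (inner_stdVec_inv_le h0 h2 hε n) ?_)
    positivity
  have hlim : Filter.Tendsto (fun ε : ℝ => D * (Q + ε * ‖ψ‖ ^ 2))
      (nhdsWithin 0 (Set.Ioi 0)) (nhds (D * Q)) := by
    have hc : Continuous fun ε : ℝ => D * (Q + ε * ‖ψ‖ ^ 2) := by fun_prop
    simpa using (hc.tendsto 0).mono_left (nhdsWithin_le_nhds (s := Set.Ioi 0))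
  exact ge_of_tendsto hlim (Filter.eventually_of_mem self_mem_nhdsWithin fun ε hε => key ε hε)

end DiscreteHardy

end

/-! ### Summation against the potential. -/

open DiscreteHardy in
theorem theorem2 (α : ℝ) (hα : 0 < α) (hα' : α < 3 / 2) (V : ℕ+ → ℝ) (hV : ∀ n, 0 ≤ V n)
    (hsum : Summable fun n : ℕ+ => hardyCoeff n α * V n)
    (hle : ∑' n : ℕ+, hardyCoeff n α * V n ≤
      2 * Real.pi * (Real.Gamma (2 * α) / Real.Gamma α ^ 2)) :
    FormGE (opPow negLaplacian α) V := by
  intro ψ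
  have g1 := Real.Gamma_pos_of_pos hα
  have g2 := Real.Gamma_pos_of_pos (show 0 < 2 * α by linarith)
  have hbound := norm_apply_sq_le hα hα' ψ
  have hg := hardyCoeff_nonneg hα hα'
  set C := 2 * Real.pi * (Real.Gamma (2 * α) / Real.Gamma α ^ 2) with hC
  have hCpos : 0 < C := by have := Real.pi_pos; positivity
  set Q := RCLike.re (inner ℂ ψ (opPow negLaplacian α ψ)) with hQdef
  have hQ : 0 ≤ Q := by
    have : 0 ≤ opPow negLaplacian α := CFC.rpow_nonneg
    exact ((ContinuousLinearMap.nonneg_iff_isPositive _).1 this).re_inner_nonneg_right ψ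
  have hterm (n : ℕ+) : V n * ‖ψ n‖ ^ 2 ≤ hardyCoeff n α * V n * (Q / C) := by
    calc V n * ‖ψ n‖ ^ 2 ≤ V n * (hardyCoeff n α / C * Q) :=
          mul_le_mul_of_nonneg_left (hbound n) (hV n)
      _ = _ := by ring
  -- Convergence has to come from `hsum`: a divergent `∑'` has the default value 0, so `hle` alone
  -- does not give it.
  have hs' : Summable fun n : ℕ+ => hardyCoeff n α * V n * (Q / C) := hsum.mul_right _
  have hs : Summable fun n : ℕ+ => V n * ‖ψ n‖ ^ 2 :=
    hs'.of_nonneg_of_le (fun n => mul_nonneg (hV n) (by positivity)) hterm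
  refine ⟨hs, ?_⟩
  calc ∑' n, V n * ‖ψ n‖ ^ 2 ≤ ∑' n, hardyCoeff n α * V n * (Q / C) := hs.tsum_le_tsum hterm hs'
    _ = (∑' n, hardyCoeff n α * V n) * (Q / C) := tsum_mul_right
    _ ≤ C * (Q / C) := by gcongr
    _ = Q := by field_simp
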